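/- **Setting (the BB84-INFO-$z$ protocol).** Let $n,n_z,n_x\ge 1$ and $r,m\ge 0$ be integers with $r+m\le n$, put $N=n+n_z+n_x$, and let $p_{a,z},p_{a,x}>0$ be thresholds. For a bit string $\mathbf x$ let $|\mathbf x|$ be its number of 1-bits. Write $|0\rangle_0=|0\rangle$, $|1\rangle_0=|1\rangle$ for the $z$ basis of a qubit, $|0\rangle_1=(|0\rangle+|1\rangle)/\sqrt2$, $|1\rangle_1=(|0\rangle-|1\rangle)/\sqrt2$ for the $x$ basis, and $|\mathbf i\rangle_{\mathbf b}=\bigotimes_{j=1}^N|i_j\rangle_{b_j}$. 1. Alice chooses $\mathbf b\in\mathbf F_2^N$ uniformly among the strings with $|\mathbf b|=n_x$, then $\mathbf s\in\mathbf F_2^N$ uniformly among the strings with $|\mathbf s|=n$ and $|\mathbf s\oplus\mathbf b|=n+n_x$ (so the 1-bits of $\mathbf s$ and $\mathbf b$ do not overlap); independently she chooses $\mathbf i\in\mathbf F_2^N$ uniformly, and, independently of all this, a pair of matrices $P_{\mathrm C}\in\mathbf F_2^{r\times n}$, $P_{\mathrm K}\in\mathbf F_2^{m\times n}$ uniformly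 among the pairs all of whose $r+m$ rows together are linearly independent. She sends $|\mathbf i\rangle_{\mathbf b}$. 2. Eve applies an arbitrary joint attack, fixed in advance: she attaches a probe in a fixed unit state $|0\rangle_{\mathrm E}$ of an arbitrary Hilbert space and applies an arbitrary unitary operator $U$ to the compound system $|0\rangle_{\mathrm E}|\mathbf i\rangle_{\mathbf b}$. The $N$ qubits are then passed on to Bob. 3. Bob measures the $N$ qubits in the bases given by $\mathbf b$ and obtains $\mathbf j\in\mathbf F_2^N$; put $\mathbf c=\mathbf i\oplus\mathbf j$. 4. The positions with $s_l=1$ are the INFO positions; the positions with $s_l=0$ are the TEST-Z positions (where $b_l=0$; there are $n_z$ of them) and the TEST-X positions (where $b_l=1$; there are $n_x$ of them). The test passes ($\mathbf T=1$) if and only if the number of 1-bits of $\mathbf c$ is at most $n_z p_{a,z}$ on the TEST-Z positions and at most $n_x p_{a,x}$ on the TEST-X positions. 5. Let $\mathbf i_{\mathrm I},\mathbf j_{\mathrm I}\in\mathbf F_2^n$ be the substrings of $\mathbf i,\mathbf j$ on the INFO positions. Alice announces $P_{\mathrm C}$ and the syndrome $\boldsymbol\xi=\mathbf i_{\mathrm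 I}P_{\mathrm C}^{\mathsf T}$. Bob decodes $\mathbf j_{\mathrm I}$ to the word of $\{\mathbf z\in\mathbf F_2^n\mid \mathbf zP_{\mathrm C}^{\mathsf T}=\boldsymbol\xi\}$ that is nearest to $\mathbf j_{\mathrm I}$ in the Hamming distance; if there is no unique nearest word, the output of the decoder is arbitrary. Alice's final key is $\mathbf k=\mathbf i_{\mathrm I}P_{\mathrm K}^{\mathsf T}$, and Bob's final key $\mathbf k^{\mathrm B}$ is the product of his decoded word with $P_{\mathrm K}^{\mathsf T}$. **Theorem.** Let $\epsilon_{\mathrm{rel}}>0$ be such that $n(p_{a,z}+\epsilon_{\mathrm{rel}})$ is an integer and $p_{a,z}+\epsilon_{\mathrm{rel}}\le\frac12$. Then, for every joint attack and every such decoder, $$\Pr\left[(\mathbf k\ne\mathbf k^{\mathrm B})\wedge(\mathbf T=1)\right]\le e^{-2\left(\frac{n_z}{n+n_z}\right)^2 n\,\epsilon_{\mathrm{rel}}^2}+2^{\,n\left[H_2(p_{a,z}+\epsilon_{\mathrm{rel}})-r/n\right]},$$ where $H_2(x)=-x\log_2 x-(1-x)\log_2(1-x)$. -/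

import Mathlib

open scoped TensorProduct BigOperators

noncomputable section

namespace BB84

/-! ### Bit strings -/

/-- Bit strings of length `t`: row vectors over the field with two elements; `+` is XOR. -/
abbrev BitString (t : ℕ) : Type := Fin t → ZMod 2

/-- The number of 1-bits of a bit string. -/
def weight {t : ℕ} (x : BitString t) : ℕ := (Finset.univ.filter fun j => x j = 1).card

/-- The Hamming distance `|x ⊕ y|`. -/
def hdist {t : ℕ} (x y : BitString t) : ℕ := weight (x + y)

/-- The binary entropy function (base-2 logarithm). -/
def H₂ (x : ℝ) : ℝ := -x * Real.logb 2 x - (1 - x) * Real.logb 2 (1 - x)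

/-! ### Qubits and the eavesdropper's joint attack -/

/-- The state space of `N` qubits; its standard orthonormal basis is the `z` (computational)
basis, indexed by the bit strings of length `N`. -/
abbrev Qubits (N : ℕ) : Type := EuclideanSpace ℂ (BitString N)

/-- The one-qubit state `|i⟩_b`: for `b = 0` the `z`-basis state `|i⟩`, and for `b = 1` the
`x`-basis state `(|0⟩ + (-1)^i |1⟩) / √2`. -/
def qubit (b i : ZMod 2) : EuclideanSpace ℂ (ZMod 2) :=
  if b = 0 then EuclideanSpace.single i 1
  else ((Real.sqrt 2 : ℝ) : ℂ)⁻¹ •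
    (EuclideanSpace.single 0 1 + (-1 : ℂ) ^ i.val • EuclideanSpace.single 1 1)

/-- The `N`-qubit product state `|i⟩_b = ⨂ⱼ |iⱼ⟩_{bⱼ}`, given by its coordinates in the
`z` basis. -/
def ket {N : ℕ} (b i : BitString N) : Qubits N :=
  WithLp.toLp 2 fun z => ∏ j, qubit (b j) (i j) (z j)

/-- A joint attack on `N` qubits with probe space `H`: an initial (unit) probe state and a
unitary operator on the compound system of the probe and all the qubits. -/
structure JointAttack (N : ℕ) (H : Type*) [NormedAddCommGroup H] [InnerProductSpace ℂ H] where
  /-- the initial state of the probe -/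
  probe : H
  norm_probe : ‖probe‖ = 1
  /-- the attack operator -/
  U : (H ⊗[ℂ] Qubits N) ≃ₗᵢ[ℂ] (H ⊗[ℂ] Qubits N)

section Attack

variable {N : ℕ} {H : Type*} [NormedAddCommGroup H] [InnerProductSpace ℂ H]

/-- The map `1 ⊗ ⟨φ|` from the compound system to the probe space. -/
def partialBra (φ : Qubits N) : (H ⊗[ℂ] Qubits N) →ₗ[ℂ] H :=
  (TensorProduct.rid ℂ H).toLinearMap ∘ₗ
    LinearMap.lTensor H ((innerSL ℂ φ : Qubits N →L[ℂ] ℂ) : Qubits N →ₗ[ℂ] ℂ)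

/-- The (non-normalized) probe state `E'_{i,j}`, i.e. the coefficient of `|j⟩_b` in the state
`U (|0⟩_E ⊗ |i⟩_b)` of the compound system after the attack. -/
def JointAttack.residual (A : JointAttack N H) (b i j : BitString N) : H :=
  partialBra (ket b j) (A.U (A.probe ⊗ₜ[ℂ] ket b i))

/-- The probability that Bob, measuring all the qubits in the bases `b`, obtains `j`, when Alice
has sent `|i⟩_b` and the attack `A` has been applied (Born's rule). -/
def JointAttack.measureProb (A : JointAttack N H) (b i j : BitString N) : ℝ :=
  ‖A.residual b i j‖ ^ 2

end Attack

/-! ### The random choices of the BB84-INFO-z protocol -/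

/-- The strings `s` of length `N` with exactly `n` 1-bits; `s` marks the `n` INFO positions. -/
abbrev InfoString (N n : ℕ) : Type := {s : BitString N // weight s = n}

/-- The substring of `x` on the INFO positions, in increasing order of position. -/
def InfoString.infoBits {N n : ℕ} (s : InfoString N n) (x : BitString N) : BitString n :=
  fun k => x ((Finset.univ.filter fun j => s.1 j = 1).orderEmbOfFin s.2 k)

/-- The set `B` of basis strings: exactly `nx` of the positions are in the `x` basis. -/
def basisStrings (N nx : ℕ) : Finset (BitString N) :=
  Finset.univ.filter fun b => weight b = nx

/-- The set `S_b`: strings of `n` 1-bits that do not overlap with the `nx` 1-bits of `b`. -/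
def infoStrings {N : ℕ} (n nx : ℕ) (b : BitString N) : Finset (InfoString N n) :=
  Finset.univ.filter fun s => weight (s.1 + b) = n + nx

open Classical in
/-- The pairs of a parity-check matrix (`r × n`) and a privacy amplification matrix (`m × n`)
all of whose `r + m` rows together are linearly independent. -/
def matrixPairs (n r m : ℕ) :
    Finset (Matrix (Fin r) (Fin n) (ZMod 2) × Matrix (Fin m) (Fin n) (ZMod 2)) :=
  Finset.univ.filter fun P => LinearIndependent (ZMod 2) (Matrix.fromRows P.1 P.2).row

/-- The classical data of one run of the protocol. -/
structure Run (N n r m : ℕ) where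
  /-- the basis string -/
  b : BitString N
  /-- the string marking the INFO positions -/
  s : InfoString N n
  /-- the parity-check matrix -/
  PC : Matrix (Fin r) (Fin n) (ZMod 2)
  /-- the privacy amplification matrix -/
  PK : Matrix (Fin m) (Fin n) (ZMod 2)
  /-- the bits sent by Alice -/
  i : BitString N
  /-- the bits measured by Bob -/
  j : BitString N

open Classical in
/-- The probability of an event in the BB84-INFO-z protocol under the attack `A`. Here `b` is
uniform in `B`, `s` is uniform in `S_b`, the pair of matrices is uniform in `matrixPairs`, `i` is
uniform (all independently of each other, except that `s` depends on `b`), and `j` has the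
distribution of Bob's measurement results given `b` and `i`. -/
def infoZProb {N : ℕ} {H : Type*} [NormedAddCommGroup H] [InnerProductSpace ℂ H]
    (n nx r m : ℕ) (A : JointAttack N H) (E : Run N n r m → Prop) : ℝ :=
  ∑ b ∈ basisStrings N nx, ∑ s ∈ infoStrings n nx b, ∑ P ∈ matrixPairs n r m,
    ∑ i : BitString N, ∑ j : BitString N,
      if E ⟨b, s, P.1, P.2, i, j⟩ then
        (1 / ((basisStrings N nx).card : ℝ)) * (1 / ((infoStrings n nx b).card : ℝ)) *
          (1 / ((matrixPairs n r m).card : ℝ)) * (1 / (2 : ℝ) ^ N) * A.measureProb b i j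
      else 0

/-! ### Error correction -/

/-- The code coset of the syndrome `ξ`: all words `z` with `z P_Cᵀ = ξ`. -/
def codeCoset {r n : ℕ} (PC : Matrix (Fin r) (Fin n) (ZMod 2)) (ξ : Fin r → ZMod 2) :
    Set (BitString n) :=
  {z | Matrix.vecMul z PC.transpose = ξ}

/-- A decoder receives a parity-check matrix, a syndrome and a word, and returns a word. -/
abbrev Decoder (r n : ℕ) : Type :=
  Matrix (Fin r) (Fin n) (ZMod 2) → (Fin r → ZMod 2) → BitString n → BitString n

/-- `D` is a nearest-word-in-code-coset decoder: whenever the code coset has a unique word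
nearest to the input word, `D` returns it. If there is a tie, the output is arbitrary. -/
def Decoder.IsNearest {r n : ℕ} (D : Decoder r n) : Prop :=
  ∀ (PC : Matrix (Fin r) (Fin n) (ZMod 2)) (ξ : Fin r → ZMod 2) (x z : BitString n),
    z ∈ codeCoset PC ξ →
    (∀ z' ∈ codeCoset PC ξ, z' ≠ z → hdist x z < hdist x z') →
    D PC ξ x = z

namespace Run

variable {N n r m : ℕ}

/-- Alice's final key `k = i_I P_Kᵀ`. -/
def aliceKey (ω : Run N n r m) : Fin m → ZMod 2 :=
  Matrix.vecMul (ω.s.infoBits ω.i) ω.PK.transpose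

/-- The syndrome `ξ = i_I P_Cᵀ` published by Alice. -/
def syndrome (ω : Run N n r m) : Fin r → ZMod 2 :=
  Matrix.vecMul (ω.s.infoBits ω.i) ω.PC.transpose

/-- Bob's final key: he decodes `j_I` with the help of the syndrome, and then applies `P_K`. -/
def bobKey (D : Decoder r n) (ω : Run N n r m) : Fin m → ZMod 2 :=
  Matrix.vecMul (D ω.PC ω.syndrome (ω.s.infoBits ω.j)) ω.PK.transpose

/-- The number of errors (1-bits of `i ⊕ j`) among the TEST bits (`s = 0`) in the basis `β`. -/
def testErrors (β : ZMod 2) (ω : Run N n r m) : ℕ :=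
  (Finset.univ.filter fun l => ω.s.1 l = 0 ∧ ω.b l = β ∧ (ω.i + ω.j) l = 1).card

/-- The test passes: at most `nz * paz` errors on the TEST-Z bits and at most `nx * pax` errors
on the TEST-X bits. -/
def TestPasses (nz nx : ℕ) (paz pax : ℝ) (ω : Run N n r m) : Prop :=
  (ω.testErrors 0 : ℝ) ≤ nz * paz ∧ (ω.testErrors 1 : ℝ) ≤ nx * pax

end Run

end BB84

end

namespace BB84

/-! ### Measurement of the qubits -/

/-! Eve's attack and Bob's measurement involve `b` and `i`, but neither `s` nor the matrices. Hence,
given `b`, `i`, `j`, the string `s` and the pair of matrices are still uniform, and it suffices to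
bound the failure probability for a fixed error string `c = i + j` (`infoZProb_le`). The only
quantum input is that `measureProb` is a probability distribution in `j`. For fixed `c` there are
two ways to fail after a passed test. Either the INFO error rate is at least `paz + ε` although the
TEST-Z rate is at most `paz`; the INFO positions form a uniform `n`-subset of the `z` positions, so
Hoeffding's inequality for sampling without replacement gives the first term
(`card_infoStrings_tail_le`). Or `c` has at most `t = n (paz + ε)` INFO errors; then wrong keys
force a different error pattern of weight at most `t` with the same syndrome as `c`
(`Run.exists_of_aliceKey_ne`). A given nonzero word is in the kernel of the random parity-check
matrix with probability at most `2 ^ (-r)`, and a union bound over the Hamming ball gives the second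
term (`card_matrixPairs_exists_le`). -/

theorem inner_qubit (b i j : ZMod 2) :
    inner ℂ (qubit b i) (qubit b j) = if i = j then (1 : ℂ) else 0 := by
  have h : ((Real.sqrt 2 : ℝ) : ℂ) * ((Real.sqrt 2 : ℝ) : ℂ) = 2 := by
    rw [← Complex.ofReal_mul, Real.mul_self_sqrt (by norm_num)]; norm_num
  -- The normalization of the `x`-basis states.
  have h2 : ((Real.sqrt 2 : ℝ) : ℂ)⁻¹ * (((Real.sqrt 2 : ℝ) : ℂ)⁻¹ * 2) = 1 := by
    rw [← h]
    have : ((Real.sqrt 2 : ℝ) : ℂ) ≠ 0 := by simp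
    field_simp
  have hval : (1 : ZMod 2).val = 1 := rfl
  have hsum : inner ℂ (qubit b i) (qubit b j) =
      qubit b j 0 * star (qubit b i 0) + qubit b j 1 * star (qubit b i 1) := by
    rw [PiLp.inner_apply]
    exact Fin.sum_univ_two _
  rw [hsum]
  have h01 : ∀ b : ZMod 2, b = 0 ∨ b = 1 := by decide
  rcases h01 b with rfl | rfl <;> rcases h01 i with rfl | rfl <;> rcases h01 j with rfl | rfl <;>
    simp [qubit, hval] <;> linear_combination h2

theorem inner_ket {N : ℕ} (b i j : BitString N) :
    inner ℂ (ket b i) (ket b j) = if i = j then (1 : ℂ) else 0 := by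
  have h : inner ℂ (ket b i) (ket b j) =
      ∏ l, inner ℂ (qubit (b l) (i l)) (qubit (b l) (j l)) := by
    simp only [PiLp.inner_apply, ket, Finset.prod_univ_sum, Fintype.piFinset_univ]
    simp [Finset.prod_mul_distrib]
  rw [h]
  simp only [inner_qubit]
  rw [Finset.prod_ite_zero]
  simp [funext_iff]

/-- The states `|j⟩_b` form an orthonormal basis. -/
noncomputable def ketBasis {N : ℕ} (b : BitString N) : OrthonormalBasis (BitString N) ℂ (Qubits N) :=
  have h : Orthonormal ℂ (ket b) := orthonormal_iff_ite.2 fun i j => inner_ket b i j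
  OrthonormalBasis.mk h
    (h.linearIndependent.span_eq_top_of_card_eq_finrank' (by simp)).ge

theorem ketBasis_apply {N : ℕ} (b j : BitString N) : ketBasis b j = ket b j := by
  simp [ketBasis]

variable {N : ℕ} {H : Type*} [NormedAddCommGroup H] [InnerProductSpace ℂ H]

theorem partialBra_tmul (φ : Qubits N) (x : H) (y : Qubits N) :
    partialBra φ (x ⊗ₜ[ℂ] y) = inner ℂ φ y • x := by
  simp [partialBra]

/-- The resolution of the identity on the qubit factor. That factor is finite-dimensional, so the
algebraic tensor product suffices for any probe space. -/
theorem sum_partialBra_tmul (B : OrthonormalBasis (BitString N) ℂ (Qubits N))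
    (ψ : H ⊗[ℂ] Qubits N) : ∑ j, partialBra (B j) ψ ⊗ₜ[ℂ] B j = ψ := by
  induction ψ using TensorProduct.induction_on with
  | zero => simp
  | tmul x y =>
    simp only [partialBra_tmul, TensorProduct.smul_tmul]
    rw [← TensorProduct.tmul_sum, B.sum_repr']
  | add x y hx hy =>
    simp only [map_add, TensorProduct.add_tmul, Finset.sum_add_distrib, hx, hy]

/-- Parseval's identity for the partial inner products with an orthonormal basis. -/
theorem sum_norm_sq_partialBra (B : OrthonormalBasis (BitString N) ℂ (Qubits N))
    (ψ : H ⊗[ℂ] Qubits N) : ∑ j, ‖partialBra (B j) ψ‖ ^ 2 = ‖ψ‖ ^ 2 := by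
  have h : inner ℂ ψ ψ = ∑ j, ((‖partialBra (B j) ψ‖ : ℂ)) ^ 2 := by
    nth_rw 1 2 [← sum_partialBra_tmul B ψ]
    simp only [sum_inner, inner_sum, TensorProduct.inner_tmul,
      orthonormal_iff_ite.1 B.orthonormal]
    simp
  rw [inner_self_eq_norm_sq_to_K (𝕜 := ℂ) ψ] at h
  exact Complex.ofReal_injective (by push_cast; exact h.symm)

theorem JointAttack.measureProb_nonneg (A : JointAttack N H) (b i j : BitString N) :
    0 ≤ A.measureProb b i j := sq_nonneg _

theorem JointAttack.sum_measureProb (A : JointAttack N H) (b i : BitString N) :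
    ∑ j, A.measureProb b i j = 1 := by
  simp only [JointAttack.measureProb, JointAttack.residual, ← ketBasis_apply b]
  rw [sum_norm_sq_partialBra, LinearIsometryEquiv.norm_map, TensorProduct.norm_tmul,
    A.norm_probe]
  simp

/-! ### Sampling without replacement -/

open MeasureTheory ProbabilityTheory in
/-- Hoeffding's lemma for a Bernoulli variable. -/
theorem one_add_mul_exp_sub_one_le (μ l : ℝ) (h0 : 0 ≤ μ) (h1 : μ ≤ 1) :
    1 + (Real.exp l - 1) * μ ≤ Real.exp (l * μ + l ^ 2 / 8) := by
  let X : Bool → ℝ := fun ω => if ω then 1 else 0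
  let P : Measure Bool := ENNReal.ofReal μ • Measure.dirac true +
    ENNReal.ofReal (1 - μ) • Measure.dirac false
  have hP : IsProbabilityMeasure P := ⟨by
    simp only [P, Measure.add_apply, Measure.smul_apply, measure_univ, smul_eq_mul, mul_one]
    rw [← ENNReal.ofReal_add h0 (by linarith)]
    simp⟩
  have hint (f : Bool → ℝ) : ∫ ω, f ω ∂P = μ * f true + (1 - μ) * f false := by
    have hd (c : ℝ) (ω₀ : Bool) : Integrable f (ENNReal.ofReal c • Measure.dirac ω₀) :=
      Integrable.smul_measure .of_finite ENNReal.ofReal_ne_top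
    rw [integral_add_measure (hd _ _) (hd _ _), integral_smul_measure, integral_smul_measure,
      integral_dirac, integral_dirac, ENNReal.toReal_ofReal h0,
      ENNReal.toReal_ofReal (by linarith)]
    simp
  -- A variable with values in an interval of length 1 has variance proxy 1/4, whence `l ^ 2 / 8`.
  -- This bounds the centered variable; multiplying by `exp (l * μ)` undoes the centering.
  have h := (hasSubgaussianMGF_of_mem_Icc (μ := P) (X := X) (a := 0) (b := 1)
    (Measurable.of_discrete.aemeasurable) (ae_of_all _ fun ω => by cases ω <;> simp [X])).mgf_le l
  rw [mgf, hint X, hint] at h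
  have h3 : Real.exp (l * μ + l ^ 2 / 8) = Real.exp (l * μ) * Real.exp (l ^ 2 / 8) :=
    Real.exp_add _ _
  have h4 : Real.exp (l * (1 - μ)) = Real.exp l * (Real.exp (l * μ))⁻¹ := by
    rw [← Real.exp_neg, ← Real.exp_add]; ring_nf
  have h5 : Real.exp (l * (0 - μ)) = (Real.exp (l * μ))⁻¹ := by
    rw [← Real.exp_neg]; ring_nf
  simp only [X, if_true, Bool.false_eq_true, if_false, mul_one, mul_zero, add_zero, h4, h5] at h
  have h6 : ((((‖(1 : ℝ) - 0‖₊ / 2) ^ 2 : NNReal) : ℝ) * l ^ 2 / 2) = l ^ 2 / 8 := by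
    push_cast; simp; ring
  rw [h6] at h
  have hpos := Real.exp_pos (l * μ)
  rw [h3]
  calc 1 + (Real.exp l - 1) * μ = Real.exp (l * μ) *
      (μ * (Real.exp l * (Real.exp (l * μ))⁻¹) + (1 - μ) * (Real.exp (l * μ))⁻¹) := by
        field_simp; ring
    _ ≤ _ := by gcongr

/-- The ratio of the binomials is the product of the `(w - i) / (M - i)`, each at most `w / M`:
drawing `k` marked items is no likelier without replacement than with it. -/
theorem choose_le_choose_mul_div_pow {w M : ℕ} (h : w ≤ M) (hM : 0 < M) (k : ℕ) :
    (w.choose k : ℝ) ≤ M.choose k * ((w : ℝ) / M) ^ k := by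
  induction k with
  | zero => simp
  | succ k ih =>
    rcases le_or_gt w k with hk | hk
    · rw [Nat.choose_eq_zero_of_lt (by omega), Nat.cast_zero]
      positivity
    have h1 : (w.choose (k + 1) : ℝ) * (k + 1) = w.choose k * (w - k) := by
      have := Nat.choose_succ_right_eq w k
      rw [← Nat.cast_sub hk.le]; exact_mod_cast this
    have h2 : (M.choose (k + 1) : ℝ) * (k + 1) = M.choose k * (M - k) := by
      have := Nat.choose_succ_right_eq M k
      rw [← Nat.cast_sub (hk.le.trans h)]; exact_mod_cast this
    have hk' : (k : ℝ) < w := by exact_mod_cast hk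
    have hw : (w : ℝ) ≤ M := by exact_mod_cast h
    have hM' : (0 : ℝ) < M := by exact_mod_cast hM
    have h3 : (w : ℝ) - k ≤ (M - k) * (w / M) := by
      have : ((M : ℝ) - k) * (w / M) = w - k * (w / M) := by field_simp
      rw [this]
      have : (w : ℝ) / M ≤ 1 := (div_le_one hM').2 hw
      nlinarith [Nat.cast_nonneg (α := ℝ) k]
    refine le_of_mul_le_mul_right ?_ (by positivity : (0 : ℝ) < k + 1)
    calc (w.choose (k + 1) : ℝ) * (k + 1) = w.choose k * (w - k) := h1
      _ ≤ (M.choose k * ((w : ℝ) / M) ^ k) * ((M - k) * (w / M)) :=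
          mul_le_mul ih h3 (by linarith) (by positivity)
      _ = (M.choose (k + 1) * (k + 1)) * ((w : ℝ) / M) ^ (k + 1) := by rw [h2]; ring
      _ = _ := by ring

open Finset in
theorem card_powersetCard_superset {α : Type*} [DecidableEq α] {K Z : Finset α} (hK : K ⊆ Z)
    {n : ℕ} (hn : #K ≤ n) :
    #{S ∈ Z.powersetCard n | K ⊆ S} = (#Z - #K).choose (n - #K) := by
  rw [← card_sdiff_of_subset hK, ← card_powersetCard]
  refine card_bij' (fun S _ => S \ K) (fun T _ => T ∪ K) ?_ ?_ ?_ ?_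
  · intro S hS
    simp only [mem_filter, mem_powersetCard] at hS ⊢
    exact ⟨sdiff_subset_sdiff hS.1.1 le_rfl, by rw [card_sdiff_of_subset hS.2, hS.1.2]⟩
  · intro T hT
    simp only [mem_filter, mem_powersetCard] at hT ⊢
    have hd : Disjoint T K := disjoint_of_subset_left hT.1 sdiff_disjoint
    refine ⟨⟨union_subset (hT.1.trans sdiff_subset) hK, ?_⟩, subset_union_right⟩
    rw [card_union_of_disjoint hd, hT.2]; omega
  · intro S hS
    simp only [mem_filter] at hS
    exact sdiff_union_of_subset hS.2
  · intro T hT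
    simp only [mem_powersetCard] at hT
    exact union_sdiff_cancel_right (disjoint_of_subset_left hT.1 sdiff_disjoint)

open Finset in
/-- The moment generating function of the hypergeometric distribution is at most that of the
binomial distribution with the same mean. -/
theorem sum_powersetCard_pow_le {α : Type*} [DecidableEq α] {Z W : Finset α} (hW : W ⊆ Z)
    {n : ℕ} (hZ : 0 < #Z) {x : ℝ} (hx : 0 ≤ x) :
    ∑ S ∈ Z.powersetCard n, (1 + x) ^ #(S ∩ W) ≤
      (#Z).choose n * (1 + x * ((#W : ℝ) / #Z)) ^ n := by
  -- Expanding over subsets `K` of `S ∩ W` and exchanging the sums leaves only the number of `S`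
  -- that contain a given `K`.
  have hexp (S : Finset α) : (1 + x) ^ #(S ∩ W) =
      ∑ K ∈ W.powerset, if K ⊆ S then x ^ #K else 0 := by
    have := prod_add_one (R := ℝ) (f := fun _ => x) (S ∩ W)
    rw [prod_const, add_comm] at this
    rw [this, ← sum_filter]
    simp only [prod_const]
    refine sum_congr ?_ fun _ _ => rfl
    ext K
    simp only [mem_powerset, mem_filter, subset_inter_iff, and_comm]
  simp only [hexp]
  rw [sum_comm]
  have hbound (K : Finset α) (hK : K ∈ W.powerset) :
      ∑ S ∈ Z.powersetCard n, (if K ⊆ S then x ^ #K else 0) =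
        x ^ #K * if #K ≤ n then ((#Z - #K).choose (n - #K) : ℝ) else 0 := by
    rw [← sum_filter, sum_const, nsmul_eq_mul, mul_comm]
    congr 1
    split_ifs with h
    · rw [card_powersetCard_superset ((mem_powerset.1 hK).trans hW) h]
    · rw [Nat.cast_eq_zero, card_eq_zero, filter_eq_empty_iff]
      intro S hS hKS
      exact h ((card_le_card hKS).trans (mem_powersetCard.1 hS).2.le)
  rw [sum_congr rfl hbound,
    sum_powerset_apply_card (fun k => x ^ k * if k ≤ n then ((#Z - k).choose (n - k) : ℝ) else 0)]
  have hle : #W ≤ #Z := card_le_card hW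
  calc _ = ∑ k ∈ range (#W + 1), if k ≤ n then
        ((#W).choose k : ℝ) * (x ^ k * ((#Z - k).choose (n - k) : ℝ)) else 0 := by
        refine sum_congr rfl fun k _ => ?_
        split_ifs <;> simp
    _ ≤ ∑ k ∈ range (#W + 1), if k ≤ n then
        ((#Z).choose n : ℝ) * (n.choose k * (x * ((#W : ℝ) / #Z)) ^ k) else 0 := by
        refine sum_le_sum fun k hk => ?_
        split_ifs with hkn
        · have h := choose_le_choose_mul_div_pow hle hZ k
          have h2 : ((#Z).choose n : ℝ) * n.choose k =
              (#Z).choose k * (#Z - k).choose (n - k) := by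
            exact_mod_cast Nat.choose_mul hkn
          calc ((#W).choose k : ℝ) * (x ^ k * ((#Z - k).choose (n - k) : ℝ))
              ≤ ((#Z).choose k * ((#W : ℝ) / #Z) ^ k) *
                (x ^ k * ((#Z - k).choose (n - k) : ℝ)) := by gcongr
            _ = (((#Z).choose k : ℝ) * (#Z - k).choose (n - k)) *
                (x * ((#W : ℝ) / #Z)) ^ k := by rw [mul_pow]; ring
            _ = _ := by rw [← h2]; ring
        · rfl
    _ ≤ ∑ k ∈ range (n + 1), ((#Z).choose n : ℝ) *
        (n.choose k * (x * ((#W : ℝ) / #Z)) ^ k) := by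
        rw [← sum_filter]
        refine sum_le_sum_of_subset_of_nonneg ?_ fun _ _ _ => by positivity
        intro k hk
        simp only [mem_filter, mem_range] at hk ⊢
        omega
    _ = _ := by
        rw [← mul_sum, add_comm 1, add_pow]
        congr 1
        refine sum_congr rfl fun k _ => ?_
        simp [mul_comm]

open Finset in
/-- Hoeffding's inequality for sampling without replacement. -/
theorem card_powersetCard_tail_le {α : Type*} [DecidableEq α] {Z W : Finset α} (hW : W ⊆ Z)
    {n : ℕ} (hZ : 0 < #Z) {δ : ℝ} (hδ : 0 ≤ δ) :
    (#{S ∈ Z.powersetCard n | (n : ℝ) * ((#W : ℝ) / #Z + δ) ≤ (#(S ∩ W) : ℝ)} : ℝ) ≤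
      (#Z).choose n * Real.exp (-2 * n * δ ^ 2) := by
  set μ : ℝ := (#W : ℝ) / #Z with hμ
  -- The Chernoff parameter `l = 4 * δ` minimizes `l ^ 2 / 8 - l * δ`, with minimum `-2 * δ ^ 2`.
  have hx : 0 ≤ Real.exp (4 * δ) - 1 := by
    have := Real.one_le_exp (by positivity : 0 ≤ 4 * δ); linarith
  have hmgf := sum_powersetCard_pow_le (n := n) hW hZ hx
  have hμ1 : μ ≤ 1 := div_le_one_of_le₀ (by exact_mod_cast card_le_card hW) (by positivity)
  have hb := one_add_mul_exp_sub_one_le μ (4 * δ) (by positivity) hμ1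
  have hpos : (0 : ℝ) ≤ 1 + (Real.exp (4 * δ) - 1) * μ := by positivity
  have hmarkov : (#{S ∈ Z.powersetCard n | (n : ℝ) * (μ + δ) ≤ (#(S ∩ W) : ℝ)} : ℝ) *
      Real.exp (4 * δ * (n * (μ + δ))) ≤
      ∑ S ∈ Z.powersetCard n, (1 + (Real.exp (4 * δ) - 1)) ^ #(S ∩ W) := by
    rw [← nsmul_eq_mul, ← sum_const]
    refine (sum_le_sum fun S hS => ?_).trans
      (sum_le_sum_of_subset_of_nonneg (filter_subset _ _) fun _ _ _ => by positivity)
    rw [add_sub_cancel, ← Real.exp_nat_mul]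
    have := (mem_filter.1 hS).2
    refine Real.exp_le_exp.2 ?_
    nlinarith
  have h2 : (1 + (Real.exp (4 * δ) - 1) * μ) ^ n ≤
      Real.exp (-2 * n * δ ^ 2) * Real.exp (4 * δ * (n * (μ + δ))) := by
    refine (pow_le_pow_left₀ hpos hb n).trans ?_
    rw [← Real.exp_nat_mul, ← Real.exp_add]
    exact Real.exp_le_exp.2 (le_of_eq (by ring))
  refine le_of_mul_le_mul_right (hmarkov.trans (hmgf.trans ?_)) (Real.exp_pos _)
  rw [mul_assoc]
  gcongr

/-! ### Random parity-check matrices -/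

/-- The isomorphism between the lines through `x` and `y` extends to an automorphism of `V`. -/
theorem exists_linearEquiv_apply_eq {K V : Type*} [Field K] [AddCommGroup V] [Module K V]
    {x y : V} (hx : x ≠ 0) (hy : y ≠ 0) : ∃ g : V ≃ₗ[K] V, g x = y := by
  obtain ⟨g, hg⟩ := Submodule.exists_linearEquiv_restrict_eq
    ((LinearEquiv.toSpanNonzeroSingleton K V x hx).symm ≪≫ₗ
      LinearEquiv.toSpanNonzeroSingleton K V y hy)
  refine ⟨g, ?_⟩
  have := hg ⟨x, Submodule.mem_span_singleton_self x⟩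
  rw [← this]
  have h1 : (LinearEquiv.toSpanNonzeroSingleton K V x hx).symm
      ⟨x, Submodule.mem_span_singleton_self x⟩ = 1 := by
    rw [LinearEquiv.symm_apply_eq]; simp
  simp [h1]

open Matrix

theorem linearIndependent_row_mul {K ι κ : Type*} [Field K] [Fintype κ] [DecidableEq κ]
    {M : Matrix ι κ K} (hM : LinearIndependent K M.row) {G : Matrix κ κ K} (hG : IsUnit G) :
    LinearIndependent K (M * G).row := by
  have h := hM.map' G.vecMulLinear
    (LinearMap.ker_eq_bot.2 (Matrix.vecMul_injective_of_isUnit hG))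
  have he : (M * G).row = G.vecMulLinear ∘ M.row := by
    funext i; exact (Matrix.mul_apply_eq_vecMul M G i)
  rw [he]
  exact h

theorem card_mulVec_eq_zero {r n : ℕ} {M : Matrix (Fin r) (Fin n) (ZMod 2)}
    (hM : LinearIndependent (ZMod 2) M.row) :
    (Finset.univ.filter fun v => M *ᵥ v = 0).card = 2 ^ (n - r) := by
  have h1 := M.mulVecLin.finrank_range_add_finrank_ker
  have h2 : M.rank = r := by rw [hM.rank_matrix]; simp
  rw [Matrix.rank] at h2
  rw [h2, Module.finrank_fin_fun] at h1
  classical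
  have h3 := Module.card_eq_pow_finrank (K := ZMod 2) (V := LinearMap.ker M.mulVecLin)
  rw [ZMod.card, show Module.finrank (ZMod 2) (LinearMap.ker M.mulVecLin) = n - r by omega] at h3
  rw [← h3, Fintype.card_subtype]
  simp [LinearMap.mem_ker]

theorem mem_matrixPairs {n r m : ℕ}
    {P : Matrix (Fin r) (Fin n) (ZMod 2) × Matrix (Fin m) (Fin n) (ZMod 2)} :
    P ∈ matrixPairs n r m ↔ LinearIndependent (ZMod 2) (Matrix.fromRows P.1 P.2).row := by
  simp [matrixPairs]

theorem linearIndependent_row_of_mem_matrixPairs {n r m : ℕ}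
    {P : Matrix (Fin r) (Fin n) (ZMod 2) × Matrix (Fin m) (Fin n) (ZMod 2)}
    (hP : P ∈ matrixPairs n r m) : LinearIndependent (ZMod 2) P.1.row :=
  (mem_matrixPairs.1 hP).comp Sum.inl Sum.inl_injective

theorem mul_mem_matrixPairs {n r m : ℕ}
    {P : Matrix (Fin r) (Fin n) (ZMod 2) × Matrix (Fin m) (Fin n) (ZMod 2)}
    (hP : P ∈ matrixPairs n r m) {G : Matrix (Fin n) (Fin n) (ZMod 2)} (hG : IsUnit G) :
    (P.1 * G, P.2 * G) ∈ matrixPairs n r m := by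
  rw [mem_matrixPairs] at hP ⊢
  simpa only [Matrix.fromRows_mul] using linearIndependent_row_mul hP hG

/-- Choose an invertible `G` with `G e' = e`. Right multiplication by `G` preserves `matrixPairs`,
is injective, and sends matrices killing `e` to matrices killing `e'`. By symmetry, all nonzero
words have equal counts. -/
theorem card_matrixPairs_mulVec_le {n r m : ℕ} {e e' : BitString n} (he : e ≠ 0) (he' : e' ≠ 0) :
    ((matrixPairs n r m).filter fun P => P.1 *ᵥ e = 0).card ≤
      ((matrixPairs n r m).filter fun P => P.1 *ᵥ e' = 0).card := by
  obtain ⟨g, hg⟩ := exists_linearEquiv_apply_eq (K := ZMod 2) he' he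
  set G := LinearMap.toMatrix' (g : BitString n →ₗ[ZMod 2] BitString n)
  have hGu : IsUnit G := (LinearEquiv.isUnit_det' g |> fun h => by
    rw [Matrix.isUnit_iff_isUnit_det, LinearMap.det_toMatrix']; exact h)
  have hGe : G *ᵥ e' = e := by
    rw [← Matrix.toLin'_apply, Matrix.toLin'_toMatrix']; exact hg
  have hcancel {k : ℕ} {X Y : Matrix (Fin k) (Fin n) (ZMod 2)} (h : X * G = Y * G) : X = Y := by
    have hd := (Matrix.isUnit_iff_isUnit_det G).1 hGu
    rw [← Matrix.mul_nonsing_inv_cancel_right G X hd, h,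
      Matrix.mul_nonsing_inv_cancel_right G Y hd]
  have hinj : Function.Injective fun P : Matrix (Fin r) (Fin n) (ZMod 2) ×
      Matrix (Fin m) (Fin n) (ZMod 2) => (P.1 * G, P.2 * G) := by
    intro P Q h
    simp only [Prod.mk.injEq] at h
    exact Prod.ext (hcancel h.1) (hcancel h.2)
  refine Finset.card_le_card_of_injOn _ (fun P hP => ?_) hinj.injOn
  simp only [Finset.coe_filter, Set.mem_ofPred_eq] at hP ⊢
  exact ⟨mul_mem_matrixPairs hP.1 hGu, by rw [← Matrix.mulVec_mulVec, hGe, hP.2]⟩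

/-- A fixed nonzero word lies in the kernel of a random parity-check matrix of `r` rows with
probability at most `2 ^ (-r)`. -/
theorem card_matrixPairs_mulVec_eq_zero_le {n r m : ℕ} (hr : r ≤ n) {e : BitString n}
    (he : e ≠ 0) :
    (((matrixPairs n r m).filter fun P => P.1 *ᵥ e = 0).card : ℝ) * 2 ^ r ≤
      (matrixPairs n r m).card := by
  set a := ((matrixPairs n r m).filter fun P => P.1 *ᵥ e = 0).card
  set M := (matrixPairs n r m).card
  -- Incidences between pairs `P` and kernel words `v`, counted by `P`: every kernel has `2 ^ (n -
  -- r)` elements.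
  have hdouble : ∑ v : BitString n, ((matrixPairs n r m).filter fun P => P.1 *ᵥ v = 0).card =
      M * 2 ^ (n - r) := by
    simp only [Finset.card_filter]
    rw [Finset.sum_comm]
    rw [Finset.sum_congr rfl fun P hP => by
      rw [← Finset.card_filter, card_mulVec_eq_zero (linearIndependent_row_of_mem_matrixPairs hP)]]
    simp [M]
  -- Counted by `v`: the zero word contributes `M`, every other word at least `a`.
  have hlow : M + (2 ^ n - 1) * a ≤ M * 2 ^ (n - r) := by
    rw [← hdouble, ← Finset.add_sum_erase _ _ (Finset.mem_univ (0 : BitString n))]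
    refine Nat.add_le_add (by simp [M]) ?_
    have hcard : (Finset.univ.erase (0 : BitString n)).card = 2 ^ n - 1 := by
      rw [Finset.card_erase_of_mem (Finset.mem_univ _)]; simp
    rw [← hcard, ← smul_eq_mul]
    exact Finset.card_nsmul_le_sum _ _ _ fun v hv =>
      card_matrixPairs_mulVec_le he (Finset.ne_of_mem_erase hv)
  -- So the `M` from the zero word absorbs the `-a`, leaving `2 ^ n * a ≤ M * 2 ^ (n - r)`.
  have haM : a ≤ M := Finset.card_filter_le _ _
  have hlow' : (M : ℝ) + (2 ^ n - 1) * a ≤ M * 2 ^ (n - r) := by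
    have h1 : (1 : ℕ) ≤ 2 ^ n := Nat.one_le_two_pow
    have : ((M + (2 ^ n - 1) * a : ℕ) : ℝ) ≤ ((M * 2 ^ (n - r) : ℕ) : ℝ) := by exact_mod_cast hlow
    push_cast [Nat.cast_sub h1] at this
    exact this
  have hpow : (2 : ℝ) ^ n = 2 ^ (n - r) * 2 ^ r := by rw [← pow_add]; congr 1; omega
  have haM' : (a : ℝ) ≤ M := by exact_mod_cast haM
  rw [hpow] at hlow'
  refine le_of_mul_le_mul_left ?_ (by positivity : (0 : ℝ) < 2 ^ (n - r))
  linarith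

/-! ### Hamming balls -/

/-- The set of 1-bits of a bit string. -/
def ones {t : ℕ} (x : BitString t) : Finset (Fin t) := Finset.univ.filter fun j => x j = 1

theorem card_ones {t : ℕ} (x : BitString t) : (ones x).card = weight x := rfl

theorem ones_injective {t : ℕ} : Function.Injective (ones (t := t)) := by
  intro x y h
  have h01 : ∀ b c : ZMod 2, (b = 1 ↔ c = 1) → b = c := by decide
  funext j
  exact h01 _ _ (by simpa [ones] using Finset.ext_iff.1 h j)

theorem two_rpow_neg_H₂ {n t : ℕ} {p : ℝ} (hp : 0 < p) (hp1 : p < 1)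
    (ht : (t : ℝ) = n * p) (htn : t ≤ n) :
    p ^ t * (1 - p) ^ (n - t) = (2 : ℝ) ^ (-(n * H₂ p)) := by
  have h2 : (0 : ℝ) < 2 := by norm_num
  have h1 : p ^ t = (2 : ℝ) ^ (Real.logb 2 p * t) := by
    rw [Real.rpow_mul h2.le, Real.rpow_logb h2 (by norm_num) hp, Real.rpow_natCast]
  have h3 : (1 - p) ^ (n - t) = (2 : ℝ) ^ (Real.logb 2 (1 - p) * (n - t)) := by
    rw [Real.rpow_mul h2.le, Real.rpow_logb h2 (by norm_num) (by linarith), ← Nat.cast_sub htn,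
      Real.rpow_natCast]
  rw [h1, h3, ← Real.rpow_add h2, H₂, ht]
  ring_nf

open Finset in
/-- The entropy bound on the volume of a Hamming ball. -/
theorem card_weight_le {n t : ℕ} {p : ℝ} (hp : 0 < p) (hp2 : p ≤ 1 / 2) (ht : (t : ℝ) = n * p)
    (htn : t ≤ n) :
    (#{e : BitString n | weight e ≤ t} : ℝ) ≤ 2 ^ (n * H₂ p) := by
  have hq : (0 : ℝ) < 1 - p := by linarith
  have hle : (#{e : BitString n | weight e ≤ t} : ℝ) * (p ^ t * (1 - p) ^ (n - t)) ≤ 1 := by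
    -- For independent bits with bias `p ≤ 1 - p`, each word of the ball has probability at least `p
    -- ^ t * (1 - p) ^ (n - t)`, and the total probability is 1.
    calc (#{e : BitString n | weight e ≤ t} : ℝ) * (p ^ t * (1 - p) ^ (n - t))
        ≤ ∑ e ∈ {e : BitString n | weight e ≤ t}, p ^ #(ones e) * (1 - p) ^ (n - #(ones e)) := by
          rw [← nsmul_eq_mul]
          refine card_nsmul_le_sum _ _ _ fun e he => ?_
          have he' : #(ones e) ≤ t := (mem_filter.1 he).2
          have e1 : p ^ t = p ^ #(ones e) * p ^ (t - #(ones e)) := by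
            rw [← pow_add]; congr 1; omega
          have e2 : (1 - p) ^ (n - #(ones e)) =
              (1 - p) ^ (t - #(ones e)) * (1 - p) ^ (n - t) := by
            rw [← pow_add]; congr 1; omega
          rw [e1, e2, mul_assoc]
          have : p ^ (t - #(ones e)) ≤ (1 - p) ^ (t - #(ones e)) :=
            pow_le_pow_left₀ hp.le (by linarith) _
          gcongr
      _ ≤ ∑ e : BitString n, p ^ #(ones e) * (1 - p) ^ (n - #(ones e)) :=
          sum_le_sum_of_subset_of_nonneg (filter_subset _ _) fun _ _ _ => by positivity
      _ = ∑ s ∈ univ.image (ones (t := n)), p ^ #s * (1 - p) ^ (n - #s) := by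
          rw [sum_image ones_injective.injOn]
      _ ≤ ∑ s : Finset (Fin n), p ^ #s * (1 - p) ^ (n - #s) :=
          sum_le_sum_of_subset_of_nonneg (subset_univ _) fun _ _ _ => by positivity
      _ = 1 := by
          rw [Fin.sum_pow_mul_eq_add_pow]; simp
  rw [two_rpow_neg_H₂ hp (by linarith) ht htn, Real.rpow_neg (by norm_num)] at hle
  rwa [← div_eq_mul_inv, div_le_one (by positivity)] at hle

/-! ### INFO and TEST positions -/

theorem weight_add {t : ℕ} (x y : BitString t) :
    weight (x + y) + 2 * (ones x ∩ ones y).card = weight x + weight y := by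
  have h : ∀ a c : ZMod 2, ((if a + c = 1 then 1 else 0) + 2 * (if a = 1 ∧ c = 1 then 1 else 0) : ℕ)
      = (if a = 1 then 1 else 0) + (if c = 1 then 1 else 0) := by decide
  simp only [weight, ones, ← Finset.filter_and, Finset.card_filter, Finset.mul_sum]
  rw [← Finset.sum_add_distrib, ← Finset.sum_add_distrib]
  exact Finset.sum_congr rfl fun j _ => h _ _

/-- The positions in the `z` basis. -/
def zPositions {N : ℕ} (b : BitString N) : Finset (Fin N) := Finset.univ.filter fun l => b l = 0

theorem zPositions_eq_compl {N : ℕ} (b : BitString N) : zPositions b = (ones b)ᶜ := by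
  have h01 : ∀ a : ZMod 2, a = 0 ↔ ¬ a = 1 := by decide
  ext l
  simp [zPositions, ones, h01]

theorem card_zPositions {M nx : ℕ} {b : BitString (M + nx)} (hb : weight b = nx) :
    (zPositions b).card = M := by
  rw [zPositions_eq_compl, Finset.card_compl, card_ones, hb]
  simp

/-- The weight of `s + b` equals `n + nx` exactly when the supports are disjoint. -/
theorem mem_infoStrings {N n nx : ℕ} {b : BitString N} (hb : weight b = nx)
    {s : InfoString N n} : s ∈ infoStrings n nx b ↔ ones s.1 ⊆ zPositions b := by
  have h := weight_add s.1 b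
  rw [s.2, hb] at h
  rw [zPositions_eq_compl, Finset.subset_compl_iff_disjoint_right, Finset.disjoint_iff_inter_eq_empty,
    ← Finset.card_eq_zero]
  simp only [infoStrings, Finset.mem_filter, Finset.mem_univ, true_and]
  omega

/-- Turns the choice of `s` into the choice of a uniform `n`-subset of the `z` positions. -/
theorem image_ones_infoStrings {N n nx : ℕ} {b : BitString N} (hb : weight b = nx) :
    (infoStrings n nx b).image (fun s => ones s.1) = (zPositions b).powersetCard n := by
  ext S
  simp only [Finset.mem_image, mem_infoStrings hb, Finset.mem_powersetCard]
  constructor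
  · rintro ⟨s, hs, rfl⟩
    exact ⟨hs, s.2⟩
  · rintro ⟨hS, hc⟩
    have hones : ones (fun l => if l ∈ S then (1 : ZMod 2) else 0) = S := by
      ext l
      simp [ones]
    exact ⟨⟨fun l => if l ∈ S then 1 else 0, by rw [← card_ones, hones, hc]⟩,
      by rwa [hones], hones⟩

theorem ones_val_injective {N n : ℕ} :
    Function.Injective fun s : InfoString N n => ones s.1 :=
  ones_injective.comp Subtype.val_injective

theorem card_infoStrings_filter {N n nx : ℕ} {b : BitString N} (hb : weight b = nx)
    (p : Finset (Fin N) → Prop) [DecidablePred p] :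
    ((infoStrings n nx b).filter fun s => p (ones s.1)).card =
      (((zPositions b).powersetCard n).filter p).card := by
  rw [← image_ones_infoStrings hb, Finset.filter_image,
    Finset.card_image_of_injective _ ones_val_injective]

theorem card_infoStrings {N n nx : ℕ} {b : BitString N} (hb : weight b = nx) :
    (infoStrings n nx b).card = (zPositions b).card.choose n := by
  rw [← Finset.card_powersetCard, ← image_ones_infoStrings hb,
    Finset.card_image_of_injective _ ones_val_injective]

theorem weight_infoBits {N n : ℕ} (s : InfoString N n) (x : BitString N) :
    weight (s.infoBits x) = (ones s.1 ∩ ones x).card := by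
  have h := Finset.map_orderEmbOfFin_univ (ones s.1) s.2
  have h2 : ones s.1 ∩ ones x = (ones s.1).filter fun l => x l = 1 := by
    ext l; simp [ones]
  rw [h2, ← h, Finset.filter_map, Finset.card_map]
  rfl

theorem Run.testErrors_zero {N n r m : ℕ} (ω : Run N n r m) :
    ω.testErrors 0 = ((zPositions ω.b ∩ ones (ω.i + ω.j)) \ ones ω.s.1).card := by
  have h01 : ∀ a : ZMod 2, a = 0 ↔ ¬ a = 1 := by decide
  unfold Run.testErrors
  congr 1
  ext l
  simp only [zPositions, ones, Finset.mem_filter, Finset.mem_univ, true_and, Finset.mem_sdiff,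
    Finset.mem_inter]
  rw [h01 (ω.s.1 l)]
  tauto

open Classical in
/-- The probability that the error rate is at most `p` on the TEST-Z bits, but at least `p + ε`
on the INFO bits, for a fixed string `c` of errors. -/
theorem card_infoStrings_tail_le {n nz nx : ℕ} (hn : 0 < n) {b c : BitString (n + nz + nx)}
    (hb : weight b = nx) {p ε : ℝ} (hε : 0 ≤ ε) :
    (((infoStrings n nx b).filter fun s =>
      (n : ℝ) * (p + ε) ≤ weight (s.infoBits c) ∧
        (((zPositions b ∩ ones c) \ ones s.1).card : ℝ) ≤ nz * p).card : ℝ) ≤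
      (infoStrings n nx b).card *
        Real.exp (-2 * ((nz : ℝ) / (n + nz)) ^ 2 * n * ε ^ 2) := by
  have hZ : (zPositions b).card = n + nz := card_zPositions hb
  have hn' : (0 : ℝ) < n + nz := by positivity
  -- The tail bound compares the INFO rate with the rate on all `n + nz` positions, not with the
  -- TEST-Z rate. Since the former is a weighted mean, a gap `ε` between INFO and TEST-Z becomes `nz
  -- / (n + nz) * ε`.
  have htail := card_powersetCard_tail_le (n := n)
    (Finset.inter_subset_left : zPositions b ∩ ones c ⊆ zPositions b) (by omega)
    (by positivity : (0 : ℝ) ≤ nz / (n + nz) * ε)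
  rw [card_infoStrings hb]
  refine le_trans ?_ (htail.trans (le_of_eq (by ring_nf)))
  rw [← card_infoStrings_filter hb, Nat.cast_le]
  refine Finset.card_le_card fun s hs => ?_
  rw [Finset.mem_filter] at hs ⊢
  obtain ⟨hsb, h1, h2⟩ := hs
  refine ⟨hsb, ?_⟩
  have hS := (mem_infoStrings hb).1 hsb
  have hinter : ones s.1 ∩ (zPositions b ∩ ones c) = ones s.1 ∩ ones c := by
    rw [← Finset.inter_assoc, Finset.inter_eq_left.2 hS]
  have hsplit := Finset.card_sdiff_add_card_inter (zPositions b ∩ ones c) (ones s.1)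
  rw [Finset.inter_comm _ (ones s.1), hinter] at hsplit
  rw [weight_infoBits] at h1
  rw [hinter, hZ, ← hsplit]
  push_cast
  set X : ℝ := ((ones s.1 ∩ ones c).card : ℝ)
  set Y : ℝ := (((zPositions b ∩ ones c) \ ones s.1).card : ℝ)
  have hform : (n : ℝ) * ((Y + X) / (n + nz) + nz / (n + nz) * ε) =
      (n * (Y + X) + n * nz * ε) / (n + nz) := by
    field_simp
  rw [hform, div_le_iff₀ hn']
  have h3 := mul_le_mul_of_nonneg_left h2 (Nat.cast_nonneg (α := ℝ) n)
  have h4 := mul_le_mul_of_nonneg_left h1 (Nat.cast_nonneg (α := ℝ) nz)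
  linarith

/-! ### Decoding -/

/-- Were Alice's word the unique nearest one, it would be decoded and the keys would agree. So some
other word `z'` of the coset is at least as near to `j_I`; its error pattern `e = j_I + z'`
satisfies `e + c_I = z' + i_I`, a nonzero word of the code. Ties count as failures. -/
theorem Run.exists_of_aliceKey_ne {N n r m : ℕ} {D : Decoder r n} (hD : D.IsNearest)
    {ω : Run N n r m} (h : ω.aliceKey ≠ ω.bobKey D) :
    ∃ e, weight e ≤ weight (ω.s.infoBits (ω.i + ω.j)) ∧ e + ω.s.infoBits (ω.i + ω.j) ≠ 0 ∧
      Matrix.mulVec ω.PC (e + ω.s.infoBits (ω.i + ω.j)) = 0 := by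
  contrapose! h
  have hc : ω.s.infoBits (ω.i + ω.j) = ω.s.infoBits ω.j + ω.s.infoBits ω.i :=
    add_comm (ω.s.infoBits ω.i) _
  have h3 : ∀ x y z : ZMod 2, x + y + (x + z) = y + z := by decide
  have h2 : ∀ x y : ZMod 2, x + y = 0 → x = y := by decide
  rw [Run.bobKey, Run.aliceKey, hD ω.PC ω.syndrome _ (ω.s.infoBits ω.i) rfl]
  intro z' hz' hne
  by_contra! hlt
  refine h (ω.s.infoBits ω.j + z') (by rw [hc]; exact hlt) ?_ ?_ <;>
    rw [hc, show ω.s.infoBits ω.j + z' + (ω.s.infoBits ω.j + ω.s.infoBits ω.i) =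
      z' + ω.s.infoBits ω.i from funext fun k => h3 _ _ _]
  · exact fun h0 => hne (funext fun k => h2 _ _ (congrFun h0 k))
  · have hz : Matrix.mulVec ω.PC z' = Matrix.mulVec ω.PC (ω.s.infoBits ω.i) := by
      have : Matrix.vecMul z' ω.PC.transpose = Matrix.vecMul (ω.s.infoBits ω.i) ω.PC.transpose := hz'
      simpa only [Matrix.vecMul_transpose] using this
    rw [Matrix.mulVec_add, hz]
    exact funext fun k => CharTwo.add_self_eq_zero _

open Classical in
/-- The union bound over the error patterns that compete with `c` in the decoding. -/
theorem card_matrixPairs_exists_le {n r m t : ℕ} (hr : r ≤ n) {p : ℝ} (hp : 0 < p)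
    (hp2 : p ≤ 1 / 2) (ht : (t : ℝ) = n * p) (htn : t ≤ n) (c : BitString n) :
    (((matrixPairs n r m).filter fun P =>
      ∃ e, weight e ≤ t ∧ e + c ≠ 0 ∧ Matrix.mulVec P.1 (e + c) = 0).card : ℝ) ≤
      (matrixPairs n r m).card * (2 ^ (n * H₂ p) / 2 ^ r) := by
  have hsub : ((matrixPairs n r m).filter fun P =>
      ∃ e, weight e ≤ t ∧ e + c ≠ 0 ∧ Matrix.mulVec P.1 (e + c) = 0) ⊆
      (Finset.univ.filter fun e : BitString n => weight e ≤ t).biUnion fun e =>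
        (matrixPairs n r m).filter fun P => e + c ≠ 0 ∧ Matrix.mulVec P.1 (e + c) = 0 := by
    intro P hP
    obtain ⟨hP, e, he, h1, h2⟩ := Finset.mem_filter.1 hP
    exact Finset.mem_biUnion.2 ⟨e, by simpa using he, by simp [hP, h1, h2]⟩
  have hone (e : BitString n) : (((matrixPairs n r m).filter fun P =>
      e + c ≠ 0 ∧ Matrix.mulVec P.1 (e + c) = 0).card : ℝ) ≤ (matrixPairs n r m).card / 2 ^ r := by
    by_cases h : e + c = 0
    · simp only [h, ne_eq, not_true, false_and, Finset.filter_false, Finset.card_empty, Nat.cast_zero]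
      positivity
    · simp only [ne_eq, h, not_false_eq_true, true_and]
      rw [le_div_iff₀ (by positivity)]
      convert card_matrixPairs_mulVec_eq_zero_le hr h
  calc _ ≤ ∑ e ∈ Finset.univ.filter fun e : BitString n => weight e ≤ t,
        (((matrixPairs n r m).filter fun P =>
          e + c ≠ 0 ∧ Matrix.mulVec P.1 (e + c) = 0).card : ℝ) := by
        exact_mod_cast (Finset.card_le_card hsub).trans Finset.card_biUnion_le
    _ ≤ (Finset.univ.filter fun e : BitString n => weight e ≤ t).card *
        ((matrixPairs n r m).card / 2 ^ r : ℝ) := by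
        rw [← nsmul_eq_mul]
        exact Finset.sum_le_card_nsmul _ _ _ fun e _ => hone e
    _ ≤ 2 ^ (n * H₂ p) * ((matrixPairs n r m).card / 2 ^ r : ℝ) := by
        gcongr
        convert card_weight_le hp hp2 ht htn
    _ = _ := by ring

/-! ### The protocol -/

/-- An average of values at most `δ`; `0 ≤ δ` covers the empty set, where `1 / 0 = 0`. -/
theorem sum_one_div_card_mul_le {α : Type*} (s : Finset α) {f : α → ℝ} {δ : ℝ} (hδ : 0 ≤ δ)
    (hf : ∀ a ∈ s, f a ≤ δ) : ∑ a ∈ s, 1 / (s.card : ℝ) * f a ≤ δ := by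
  rw [← Finset.mul_sum]
  rcases Nat.eq_zero_or_pos s.card with h | h
  · simpa [h] using hδ
  · have hs : ∑ a ∈ s, f a ≤ s.card * δ := by
      simpa using Finset.sum_le_card_nsmul s f δ hf
    have : (0 : ℝ) < s.card := by exact_mod_cast h
    rw [one_div, inv_mul_le_iff₀ this]
    exact hs

open Classical in
/-- To bound the probability of an event, it is enough to bound it conditionally on the bases,
on Alice's bits and on Bob's results: these are independent of the other choices given the
bases. -/
theorem infoZProb_le {N : ℕ} {H : Type*} [NormedAddCommGroup H] [InnerProductSpace ℂ H]
    {n nx r m : ℕ} (A : JointAttack N H) (E : Run N n r m → Prop) {δ : ℝ} (hδ : 0 ≤ δ)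
    (hE : ∀ b i j, weight b = nx →
      ∑ s ∈ infoStrings n nx b,
        (((matrixPairs n r m).filter fun P => E ⟨b, s, P.1, P.2, i, j⟩).card : ℝ) ≤
        (infoStrings n nx b).card * (matrixPairs n r m).card * δ) :
    infoZProb n nx r m A E ≤ δ := by
  have hcond (b i j : BitString N) (hb : weight b = nx) :
      1 / ((infoStrings n nx b).card : ℝ) * (1 / ((matrixPairs n r m).card : ℝ)) *
        ∑ s ∈ infoStrings n nx b,
          (((matrixPairs n r m).filter fun P => E ⟨b, s, P.1, P.2, i, j⟩).card : ℝ) ≤ δ := by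
    refine (mul_le_mul_of_nonneg_left (hE b i j hb) (by positivity)).trans ?_
    have h1 (k : ℕ) : 1 / (k : ℝ) * k ≤ 1 := by
      rw [one_div]; exact inv_mul_le_one
    calc _ = (1 / ((infoStrings n nx b).card : ℝ) * (infoStrings n nx b).card) *
          (1 / ((matrixPairs n r m).card : ℝ) * (matrixPairs n r m).card) * δ := by ring
      _ ≤ 1 * 1 * δ := by
        gcongr
        · exact h1 _
        · exact h1 _
      _ = δ := by ring
  -- The sums over `s` and the matrices can move inside, because `measureProb` depends on neither.
  have hrw : infoZProb n nx r m A E = ∑ b ∈ basisStrings N nx, 1 / ((basisStrings N nx).card : ℝ) *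
      ∑ i : BitString N, 1 / ((Finset.univ : Finset (BitString N)).card : ℝ) *
        ∑ j, A.measureProb b i j *
          (1 / ((infoStrings n nx b).card : ℝ) * (1 / ((matrixPairs n r m).card : ℝ)) *
            ∑ s ∈ infoStrings n nx b,
              (((matrixPairs n r m).filter fun P => E ⟨b, s, P.1, P.2, i, j⟩).card : ℝ)) := by
    unfold infoZProb
    refine Finset.sum_congr rfl fun b _ => ?_
    have hsw (s : InfoString N n) (F : Matrix (Fin r) (Fin n) (ZMod 2) ×
        Matrix (Fin m) (Fin n) (ZMod 2) → BitString N → BitString N → ℝ) :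
        ∑ P ∈ matrixPairs n r m, ∑ i, ∑ j, F P i j =
          ∑ i, ∑ j, ∑ P ∈ matrixPairs n r m, F P i j := by
      rw [Finset.sum_comm]
      exact Finset.sum_congr rfl fun i _ => Finset.sum_comm
    rw [Finset.sum_congr rfl fun s _ => hsw s _, Finset.sum_comm, Finset.mul_sum]
    refine Finset.sum_congr rfl fun i _ => ?_
    rw [Finset.sum_comm, Finset.mul_sum, Finset.mul_sum]
    refine Finset.sum_congr rfl fun j _ => ?_
    simp only [Finset.mul_sum]
    refine Finset.sum_congr rfl fun s _ => ?_
    rw [← Finset.sum_filter, Finset.sum_const, nsmul_eq_mul]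
    have hcard : ((Finset.univ : Finset (BitString N)).card : ℝ) = 2 ^ N := by simp
    rw [hcard]
    ring
  rw [hrw]
  refine sum_one_div_card_mul_le _ hδ fun b hb => ?_
  refine sum_one_div_card_mul_le _ hδ fun i _ => ?_
  calc _ ≤ ∑ j, A.measureProb b i j * δ :=
        Finset.sum_le_sum fun j _ => mul_le_mul_of_nonneg_left
          (hcond b i j (Finset.mem_filter.1 hb).2) (A.measureProb_nonneg b i j)
    _ = δ := by rw [← Finset.sum_mul, A.sum_measureProb, one_mul]

end BB84

theorem mainTheorem11
    {H : Type*} [NormedAddCommGroup H] [InnerProductSpace ℂ H]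
    (n nz nx r m : ℕ) (hn : 0 < n) (hnz : 0 < nz) (hnx : 0 < nx) (hrm : r + m ≤ n)
    (paz pax ε : ℝ) (hpaz : 0 < paz) (hpax : 0 < pax) (hε : 0 < ε)
    (ht : ∃ t : ℤ, (t : ℝ) = n * (paz + ε)) (hhalf : paz + ε ≤ 1 / 2)
    (A : BB84.JointAttack (n + nz + nx) H)
    (D : BB84.Decoder r n) (hD : D.IsNearest) :
    BB84.infoZProb n nx r m A
        (fun ω => ω.aliceKey ≠ ω.bobKey D ∧ ω.TestPasses nz nx paz pax)
      ≤ Real.exp (-2 * ((nz : ℝ) / (n + nz)) ^ 2 * n * ε ^ 2)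
        + (2 : ℝ) ^ ((n : ℝ) * (BB84.H₂ (paz + ε) - (r : ℝ) / n)) := by
  classical
  have hn' : (0 : ℝ) < n := by exact_mod_cast hn
  obtain ⟨t, ht⟩ : ∃ t : ℕ, (t : ℝ) = n * (paz + ε) := by
    obtain ⟨t, ht⟩ := ht
    have h0 : 0 ≤ t := by
      have : (0 : ℝ) ≤ t := by rw [ht]; positivity
      exact_mod_cast this
    lift t to ℕ using h0
    exact ⟨t, by exact_mod_cast ht⟩
  have htn : t ≤ n := by
    have : (t : ℝ) ≤ n := by rw [ht]; nlinarith
    exact_mod_cast this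
  have hexp : (2 : ℝ) ^ ((n : ℝ) * (BB84.H₂ (paz + ε) - (r : ℝ) / n)) =
      2 ^ (n * BB84.H₂ (paz + ε)) / 2 ^ r := by
    rw [← Real.rpow_natCast, ← Real.rpow_sub (by norm_num)]
    congr 1
    field_simp
  rw [hexp]
  generalize hE : (fun ω : BB84.Run (n + nz + nx) n r m =>
    ω.aliceKey ≠ ω.bobKey D ∧ ω.TestPasses nz nx paz pax) = E
  refine BB84.infoZProb_le A _ (by positivity) fun b i j hb => ?_
  set δ₁ := Real.exp (-2 * ((nz : ℝ) / (n + nz)) ^ 2 * n * ε ^ 2)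
  set δ₂ : ℝ := 2 ^ (n * BB84.H₂ (paz + ε)) / 2 ^ r
  set M : ℝ := ((BB84.matrixPairs n r m).card : ℝ)
  have hM : 0 ≤ M := Nat.cast_nonneg _
  have hδ₂ : 0 ≤ δ₂ := by positivity
  have htail := BB84.card_infoStrings_tail_le (c := i + j) hn hb (p := paz) hε.le
  set bad : BB84.InfoString (n + nz + nx) n → Prop := fun s =>
    (n : ℝ) * (paz + ε) ≤ BB84.weight (s.infoBits (i + j)) ∧
      (((BB84.zPositions b ∩ BB84.ones (i + j)) \ BB84.ones s.1).card : ℝ) ≤ nz * paz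
  -- For a bad `s` all matrix pairs are counted; for any other `s` the union bound over error
  -- patterns applies.
  calc _ ≤ ∑ s ∈ BB84.infoStrings n nx b, ((if bad s then M else 0) + M * δ₂) := by
        refine Finset.sum_le_sum fun s _ => ?_
        by_cases hs : bad s
        · rw [if_pos hs]
          exact (Nat.cast_le.2 (Finset.card_filter_le _ _)).trans
            (le_add_of_nonneg_right (by positivity))
        · rw [if_neg hs, zero_add]
          refine le_trans ?_ (BB84.card_matrixPairs_exists_le (by omega) (by positivity) hhalf ht
            htn (s.infoBits (i + j)))
          rw [Nat.cast_le]
          refine Finset.card_le_card fun P hP => ?_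
          rw [Finset.mem_filter] at hP ⊢
          obtain ⟨hP, hEP⟩ := hP
          rw [← hE] at hEP
          obtain ⟨hkey, htest, -⟩ := hEP
          obtain ⟨e, he, h1, h2⟩ := BB84.Run.exists_of_aliceKey_ne hD hkey
          refine ⟨hP, e, he.trans ?_, h1, h2⟩
          rw [BB84.Run.testErrors_zero] at htest
          -- With the test passed, more than `t` INFO errors would make `s` bad.
          by_contra! hlt
          exact hs ⟨by rw [← ht]; exact_mod_cast hlt.le, htest⟩
    _ = ((BB84.infoStrings n nx b).filter bad).card * M +
        (BB84.infoStrings n nx b).card * (M * δ₂) := by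
        rw [Finset.sum_add_distrib, ← Finset.sum_filter]
        simp only [Finset.sum_const, nsmul_eq_mul]
    _ ≤ (BB84.infoStrings n nx b).card * δ₁ * M + (BB84.infoStrings n nx b).card * (M * δ₂) := by
        gcongr
    _ = _ := by ring
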